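/- Theorem 4.1 (Darboux transformation with sources). Let $\mathbb K=\mathbb R$ or $\mathbb C$, and let $\Omega\subseteq\mathbb R^2$ be an open set of points $(x,t)$ such that $(x,t)\in\Omega$ and $y\le x$ imply $(y,t)\in\Omega$ (for instance $\Omega=\mathbb R^2$). All functions below are $\mathbb K$-valued and $C^\infty$ on $\Omega$, all equations are meant on $\Omega$, $\partial=\partial/\partial x$, and $\partial^{-1}g=\int_{-\infty}^x g\,dx$ (as a convergent improper integral) for functions. Define differential polynomials in $u$ by $b_0=0$, $b_1=1$, $$b_{k+1}=Lb_k\ (k\ge1),\qquad L=-\tfrac14\partial^2-u+\tfrac12\partial^{-1}u_x,\qquad a_k=-\tfrac12 b_{k,x},$$ where on differential polynomials $\partial^{-1}$ is the antiderivative without constant term. Fix integers $n,N\ge0$, constants $\alpha,\eta,\lambda_1,\dots,\lambda_N,\xi_1\in\mathbb K$ with $\lambda_j\ne\xi_1$ for all $j$, and for each $j$ a square root $\sqrt{\lambda_j-\xi_1}\in\mathbb K$ (assumed to exist if $\mathbb K=\mathbb R$). The $n$-th KdV equation with $N$ self-consistent sources is the system $$u_{t}=\partial\Big[-2b_{n+2}[u]-2\alpha\sum_{j=1}^N\phi_j^2\Big],\qquad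 \phi_{j,xx}+(\lambda_j+u)\phi_j=0,\quad j=1,\dots,N. \tag{1}$$ Its Lax representation with spectral parameter $\lambda\in\mathbb K$ is $$\psi_{xx}+(\lambda+u)\psi=0, \tag{a5a}$$ $$\psi_{t}=\sum_{i=0}^{n+1}\lambda^{n+1-i}\,(a_i[u]\psi+b_i[u]\psi_x)+\eta\psi+\alpha\sum_{j=1}^N\phi_j\,\partial^{-1}(\phi_j\psi). \tag{a5c}$$ A solution $\psi$ of (a5a), (a5c) is always understood to satisfy the decay condition that the integrals $\partial^{-1}(\phi_j\psi)$ converge and $\phi_{j,x}\psi-\phi_j\psi_x\to0$ as $x\to-\infty$, for each $j$ and each $t$. Let $u,\phi_1,\dots,\phi_N$ be a solution of (1), and let $f_1$ be a solution of (a5a), (a5c) with $\lambda=\xi_1$ that vanishes nowhere on $\Omega$. Put $$\bar u=u+2\partial^2\ln f_1,\qquad \bar\phi_j=\frac{1}{\sqrt{\lambda_j-\xi_1}}\Big[\phi_{j,x}-\frac{f_{1,x}}{f_1}\phi_j\Big],\qquad \bar\psi=\psi_x-\frac{f_{1,x}}{f_1}\psi,$$ where $\partial^2\ln f_1=\partial(f_{1,x}/f_1)$.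 Then: 1. $\bar u,\bar\phi_1,\dots,\bar\phi_N$ is again a solution of (1), with the same $n$, $N$, $\alpha$ and $\lambda_j$. 2. For every $\lambda\in\mathbb K$ and every solution $\psi$ of (a5a), (a5c) for which the products $\bar\phi_j\psi$ tend to $0$ as $x\to-\infty$ (for each $j$ and $t$), the function $\bar\psi$ is a solution of (a5a), (a5c), including the decay condition, with $u,\phi_j$ replaced by $\bar u,\bar\phi_j$ and with the same $n,\alpha,\eta,\lambda_j,\lambda$. -/

import Mathlib

open scoped ContDiff Topology

noncomputable section

namespace KdVSources

/-! ### Differential polynomials and the KdV recursion -/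

/-- Differential polynomials in one indeterminate `u`; the variable `X i` stands for the `i`-th
`x`-derivative of `u`. -/
abbrev DiffPoly : Type := MvPolynomial ℕ ℚ

/-- The total derivative `∂ = ∂/∂x`, the derivation with `∂ u⁽ⁱ⁾ = u⁽ⁱ⁺¹⁾`. -/
def totalD : Derivation ℚ DiffPoly DiffPoly :=
  MvPolynomial.mkDerivation ℚ (fun i => MvPolynomial.X (i + 1))

open Classical in
/-- The inverse `∂⁻¹` on differential polynomials: `totalDInv P` is the differential polynomial
without constant term whose total derivative is `P` (and `0` if `P` is not a total derivative). -/
def totalDInv (P : DiffPoly) : DiffPoly :=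
  if h : ∃ Q : DiffPoly, MvPolynomial.constantCoeff Q = 0 ∧ totalD Q = P then h.choose else 0

/-- The recursion operator `L = -¼ ∂² - u + ½ ∂⁻¹ u_x`. -/
def recL (P : DiffPoly) : DiffPoly :=
  -((1 / 4 : ℚ) • totalD (totalD P)) - MvPolynomial.X 0 * P
    + (1 / 2 : ℚ) • totalDInv (MvPolynomial.X 1 * P)

/-- `b₀ = 0`, `b₁ = 1`, and `b_{k+1} = L b_k` for `k ≥ 1`. -/
def bPoly : ℕ → DiffPoly
  | 0 => 0
  | 1 => 1
  | k + 2 => recL (bPoly (k + 1))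

/-- `a_k = -½ ∂ b_k`. -/
def aPoly (k : ℕ) : DiffPoly := -((1 / 2 : ℚ) • totalD (bPoly k))

/-- The third order operator `∂ L = -¼ ∂³ - u ∂ - ½ u_x`. -/
def lenard (P : DiffPoly) : DiffPoly :=
  -((1 / 4 : ℚ) • totalD (totalD (totalD P))) - MvPolynomial.X 0 * totalD P
    - (1 / 2 : ℚ) • (MvPolynomial.X 1 * P)

theorem constantCoeff_totalD (P : DiffPoly) : MvPolynomial.constantCoeff (totalD P) = 0 := by
  induction P using MvPolynomial.induction_on with
  | C a => simp [totalD]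
  | add p q hp hq => simp [hp, hq]
  | mul_X p i hp => simp [totalD, Derivation.leibniz] at hp ⊢

theorem totalDInv_spec {P : DiffPoly} (h : ∃ Q : DiffPoly, totalD Q = P) :
    MvPolynomial.constantCoeff (totalDInv P) = 0 ∧ totalD (totalDInv P) = P := by
  have h' : ∃ Q : DiffPoly, MvPolynomial.constantCoeff Q = 0 ∧ totalD Q = P := by
    obtain ⟨Q, hQ⟩ := h
    exact ⟨Q - MvPolynomial.C (MvPolynomial.constantCoeff Q), by simp, by rw [map_sub, hQ]; simp [totalD]⟩
  unfold totalDInv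
  rw [dif_pos h']
  exact h'.choose_spec

theorem exact_lenard (c : ℕ → DiffPoly) (h0 : c 0 = 1) (m : ℕ)
    (h : ∀ j < m, totalD (c (j + 1)) = lenard (c j)) :
    ∃ Q : DiffPoly, totalD Q = lenard (c m) := by
  have hD1 : totalD (MvPolynomial.X 0) = MvPolynomial.X 1 := by simp [totalD]
  have key : totalD (∑ p ∈ Finset.HasAntidiagonal.antidiagonal m,
      ((1 / 4 : ℚ) • (totalD (c p.1) * totalD (c p.2))
        - (1 / 2 : ℚ) • (c p.1 * totalD (totalD (c p.2)))
        - MvPolynomial.X 0 * (c p.1 * c p.2)))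
      = ∑ p ∈ Finset.HasAntidiagonal.antidiagonal m, (2 : ℚ) • (c p.1 * lenard (c p.2)) := by
    set F : ℕ × ℕ → DiffPoly := fun p =>
      (1 / 4 : ℚ) • (totalD (totalD (c p.1)) * totalD (c p.2))
        + MvPolynomial.X 0 * (c p.1 * totalD (c p.2)) with hF
    have hs : ∑ p ∈ Finset.HasAntidiagonal.antidiagonal m, F p.swap = ∑ p ∈ Finset.HasAntidiagonal.antidiagonal m, F p :=
      Finset.Nat.sum_antidiagonal_swap (f := F)
    rw [← sub_eq_zero] at hs ⊢
    rw [← Finset.sum_sub_distrib] at hs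
    rw [map_sum, ← Finset.sum_sub_distrib, ← neg_eq_zero, ← hs, ← Finset.sum_neg_distrib]
    refine Finset.sum_congr rfl fun p _ => ?_
    simp only [hF, lenard, map_sub, Derivation.map_smul, Derivation.leibniz, hD1, smul_eq_mul,
      Prod.fst_swap, Prod.snd_swap]
    simp only [MvPolynomial.smul_eq_C_mul]
    have e1 : (MvPolynomial.C (1 / 2 : ℚ) : DiffPoly) = 2 * MvPolynomial.C (1 / 4 : ℚ) := by
      rw [← map_ofNat MvPolynomial.C 2, ← map_mul]; norm_num
    have e2 : (4 : DiffPoly) * MvPolynomial.C (1 / 4 : ℚ) = 1 := by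
      rw [← map_ofNat MvPolynomial.C 4, ← map_mul]; norm_num
    have e3 : (MvPolynomial.C (2 : ℚ) : DiffPoly) = 2 := map_ofNat _ _
    rw [e1, e3]
    linear_combination (-MvPolynomial.X 1 * c p.1 * c p.2) * e2
  have key2 : ∃ R : DiffPoly, totalD R
      = ∑ p ∈ Finset.HasAntidiagonal.antidiagonal m, (2 : ℚ) • (c p.1 * lenard (c p.2))
        - (2 : ℚ) • lenard (c m) := by
    cases m with
    | zero => exact ⟨0, by simp [h0]⟩
    | succ n =>
      refine ⟨∑ p ∈ Finset.HasAntidiagonal.antidiagonal n, c (p.1 + 1) * c (p.2 + 1), ?_⟩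
      rw [Finset.Nat.sum_antidiagonal_succ, h0, one_mul, add_sub_cancel_left, map_sum]
      set G : ℕ × ℕ → DiffPoly := fun p => c (p.1 + 1) * totalD (c (p.2 + 1)) with hG
      have hs : ∑ p ∈ Finset.HasAntidiagonal.antidiagonal n, G p.swap = ∑ p ∈ Finset.HasAntidiagonal.antidiagonal n, G p :=
        Finset.Nat.sum_antidiagonal_swap (f := G)
      calc _ = ∑ p ∈ Finset.HasAntidiagonal.antidiagonal n, (G p + G p.swap) := by
              refine Finset.sum_congr rfl fun p _ => ?_
              simp [hG, Derivation.leibniz]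
        _ = ∑ p ∈ Finset.HasAntidiagonal.antidiagonal n, (2 : ℚ) • G p := by
              rw [Finset.sum_add_distrib, hs, ← Finset.smul_sum, two_smul]
        _ = _ := by
              refine Finset.sum_congr rfl fun p hp => ?_
              have := Finset.HasAntidiagonal.mem_antidiagonal.mp hp
              simp only [hG]
              rw [h p.2 (by omega)]
  obtain ⟨R, hR⟩ := key2
  refine ⟨(1 / 2 : ℚ) • ((∑ p ∈ Finset.HasAntidiagonal.antidiagonal m,
      ((1 / 4 : ℚ) • (totalD (c p.1) * totalD (c p.2))
        - (1 / 2 : ℚ) • (c p.1 * totalD (totalD (c p.2)))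
        - MvPolynomial.X 0 * (c p.1 * c p.2))) - R), ?_⟩
  · rw [Derivation.map_smul, map_sub, key, hR, sub_sub_cancel, smul_smul]
    norm_num

theorem lenard_eq (P : DiffPoly) : lenard P
    = totalD (-((1 / 4 : ℚ) • totalD (totalD P)) - MvPolynomial.X 0 * P)
      + (1 / 2 : ℚ) • (MvPolynomial.X 1 * P) := by
  have hD1 : totalD (MvPolynomial.X 0) = MvPolynomial.X 1 := by simp [totalD]
  simp only [lenard, map_sub, map_neg, Derivation.map_smul, Derivation.leibniz, hD1, smul_eq_mul]
  have : (MvPolynomial.X 1 * P : DiffPoly) = (1 / 2 : ℚ) • (MvPolynomial.X 1 * P)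
      + (1 / 2 : ℚ) • (MvPolynomial.X 1 * P) := by
    rw [← add_smul]; norm_num
  linear_combination this

/-- The antiderivative in `b_{k+1} = L b_k` always exists: `∂ b_{k+1} = ∂ L b_k`. -/
theorem totalD_bPoly_succ (k : ℕ) :
    totalD (bPoly (k + 2)) = lenard (bPoly (k + 1)) := by
  induction k using Nat.strong_induction_on with
  | _ k ih =>
    obtain ⟨Q, hQ⟩ := exact_lenard (fun i => bPoly (i + 1)) rfl k ih
    have hex : ∃ Q : DiffPoly, totalD Q = MvPolynomial.X 1 * bPoly (k + 1) := by
      refine ⟨(2 : ℚ) • (Q - (-((1 / 4 : ℚ) • totalD (totalD (bPoly (k + 1))))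
        - MvPolynomial.X 0 * bPoly (k + 1))), ?_⟩
      rw [Derivation.map_smul, map_sub, hQ]
      rw [lenard_eq, add_sub_cancel_left, smul_smul]
      norm_num
    have := (totalDInv_spec hex).2
    rw [lenard_eq, bPoly, recL, map_add, Derivation.map_smul, this]

theorem totalD_pderiv (m : ℕ) (P : DiffPoly) :
    MvPolynomial.pderiv (m + 1) (totalD P)
      = totalD (MvPolynomial.pderiv (m + 1) P) + MvPolynomial.pderiv m P := by
  classical
  induction P using MvPolynomial.induction_on with
  | C a => simp [totalD]
  | add p q hp hq => simp only [map_add, hp, hq]; ring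
  | mul_X p i hp =>
    have h1 : totalD (MvPolynomial.X i) = MvPolynomial.X (i + 1) := by simp [totalD]
    have h2 : ∀ j k : ℕ, MvPolynomial.pderiv j (MvPolynomial.X k : DiffPoly)
        = if k = j then 1 else 0 := by
      intro j k
      split_ifs with h
      · rw [h, MvPolynomial.pderiv_X_self]
      · exact MvPolynomial.pderiv_X_of_ne h
    have h3 : totalD (if i = m + 1 then (1 : DiffPoly) else 0) = 0 := by
      split_ifs <;> simp
    simp only [Derivation.leibniz, map_add, smul_eq_mul, h1, hp, h2, h3, add_left_inj]
    ring

/-- A differential polynomial without constant term is determined by its total derivative. -/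
theorem eq_zero_of_totalD_eq_zero {P : DiffPoly} (h0 : MvPolynomial.constantCoeff P = 0)
    (h : totalD P = 0) : P = 0 := by
  classical
  have step : ∀ m, MvPolynomial.pderiv (m + 1) P = 0 → MvPolynomial.pderiv m P = 0 := by
    intro m hm
    have := totalD_pderiv m P
    rw [h, hm] at this
    simpa using this.symm
  obtain ⟨N, hN⟩ : ∃ N, ∀ m ∈ P.vars, m < N :=
    ⟨P.vars.sup id + 1, fun m hm => Nat.lt_succ_of_le (Finset.le_sup (f := id) hm)⟩
  have all : ∀ m, MvPolynomial.pderiv m P = 0 := by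
    intro m
    have big : ∀ k, N ≤ k → MvPolynomial.pderiv k P = 0 := fun k hk =>
      MvPolynomial.pderiv_eq_zero_of_notMem_vars fun hm => absurd (hN k hm) (by omega)
    have : ∀ k, MvPolynomial.pderiv (m + k) P = 0 → MvPolynomial.pderiv m P = 0 := by
      intro k
      induction k with
      | zero => exact id
      | succ k ih => exact fun hk => ih (step _ hk)
    exact this N (big _ (by omega))
  ext d
  rw [MvPolynomial.coeff_zero]
  by_cases hd : d = 0
  · subst hd; exact h0
  · obtain ⟨i, hi⟩ : ∃ i, d i ≠ 0 := by
      by_contra hcon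
      push Not at hcon
      exact hd (Finsupp.ext hcon)
    have hle : Finsupp.single i 1 ≤ d := by
      rw [Finsupp.single_le_iff]; omega
    have := MvPolynomial.coeff_pderiv P (i := i) (d - Finsupp.single i 1)
    rw [all i, MvPolynomial.coeff_zero, tsub_add_cancel_of_le hle] at this
    rcases mul_eq_zero.mp this.symm with h' | h'
    · exact h'
    · exact absurd h' (by positivity)

/-! ### Functions of `(x, t)` -/

variable {𝕜 : Type*} [RCLike 𝕜]

/-- Partial derivative in `x`. -/
def px (g : ℝ → ℝ → 𝕜) : ℝ → ℝ → 𝕜 := fun x t => deriv (fun y => g y t) x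

/-- Partial derivative in `t`. -/
def pt (g : ℝ → ℝ → 𝕜) : ℝ → ℝ → 𝕜 := fun x t => deriv (fun s => g x s) t

/-- Joint smoothness on a set of points `(x, t)`. -/
def SmoothOn (Ω : Set (ℝ × ℝ)) (g : ℝ → ℝ → 𝕜) : Prop :=
  ContDiffOn ℝ ∞ (fun p : ℝ × ℝ => g p.1 p.2) Ω

/-- An open set of points `(x, t)` that contains, with each of its points, the whole half-line to
the left of it (for example the whole plane). -/
def LeftDomain (Ω : Set (ℝ × ℝ)) : Prop :=
  IsOpen Ω ∧ ∀ x t y : ℝ, (x, t) ∈ Ω → y ≤ x → (y, t) ∈ Ω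

/-- The value of a differential polynomial on a function `u(x, t)`. -/
def evalDP (P : DiffPoly) (u : ℝ → ℝ → 𝕜) : ℝ → ℝ → 𝕜 := fun x t =>
  MvPolynomial.aeval (fun i => (px^[i] u) x t) P

/-- `A⁽ⁿ⁾(u, λ) ψ = ∑_{i=0}^{n+1} λ^{n+1-i} (a_i[u] + b_i[u] ∂) ψ`. -/
def opA (n : ℕ) (u : ℝ → ℝ → 𝕜) (lam : 𝕜) (ψ : ℝ → ℝ → 𝕜) : ℝ → ℝ → 𝕜 := fun x t =>
  ∑ i ∈ Finset.range (n + 2),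
    (evalDP (aPoly i) u x t * ψ x t + evalDP (bPoly i) u x t * px ψ x t) * lam ^ (n + 1 - i)

/-- The improper integral `∫_{-∞}^x g(y, t) dy` converges to `v`. -/
def HasDInv (g : ℝ → ℝ → 𝕜) (x t : ℝ) (v : 𝕜) : Prop :=
  Filter.Tendsto (fun a : ℝ => ∫ y in a..x, g y t) Filter.atBot (𝓝 v)

/-- `∂⁻¹ g = ∫_{-∞}^x g dx`, as an improper integral. -/
def dInv (g : ℝ → ℝ → 𝕜) : ℝ → ℝ → 𝕜 := fun x t =>
  Filter.limUnder Filter.atBot (fun a : ℝ => ∫ y in a..x, g y t)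

/-- `B_N ψ = α ∑_j φ_j ∂⁻¹(φ_j ψ)`. -/
def opB {N : ℕ} (α : 𝕜) (φ : Fin N → ℝ → ℝ → 𝕜) (ψ : ℝ → ℝ → 𝕜) : ℝ → ℝ → 𝕜 := fun x t =>
  α * ∑ j, φ j x t * dInv (fun y s => φ j y s * ψ y s) x t

/-- `g(x, t) → 0` as `x → -∞`, for every time `t` occurring in `Ω`. -/
def DecaysOn (Ω : Set (ℝ × ℝ)) (g : ℝ → ℝ → 𝕜) : Prop :=
  ∀ x t : ℝ, (x, t) ∈ Ω → Filter.Tendsto (fun y => g y t) Filter.atBot (𝓝 0)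

/-- `u, φ_1, …, φ_N` is a smooth solution on `Ω` of the `n`-th KdV equation with self-consistent
sources: `u_t = ∂(-2 b_{n+2}[u] - 2α ∑ φ_j²)`, `φ_{j,xx} + (λ_j + u) φ_j = 0`. -/
structure IsSourceSolution (Ω : Set (ℝ × ℝ)) (n : ℕ) {N : ℕ} (α : 𝕜) (lam : Fin N → 𝕜)
    (u : ℝ → ℝ → 𝕜) (φ : Fin N → ℝ → ℝ → 𝕜) : Prop where
  smooth_u : SmoothOn Ω u
  smooth_φ : ∀ j, SmoothOn Ω (φ j)
  evolution : ∀ x t, (x, t) ∈ Ω → pt u x t =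
    px (fun y s => -2 * evalDP (bPoly (n + 2)) u y s - 2 * α * ∑ j, φ j y s ^ 2) x t
  spectral : ∀ j, ∀ x t, (x, t) ∈ Ω → px (px (φ j)) x t + (lam j + u x t) * φ j x t = 0

/-- `ψ` is a smooth solution on `Ω` of the Lax representation with spectral parameter `mu`:
`ψ_xx + (mu + u) ψ = 0` and `ψ_t = A⁽ⁿ⁾ψ + ηψ + B_N ψ`.  The products of `φ_j` with `ψ` decay at
`x = -∞` in the sense that `φ_{j,x}ψ - φ_jψ_x → 0`, so that
`φ_{j,x}ψ - φ_jψ_x = (mu - λ_j) ∂⁻¹(φ_jψ)`, and that the integral `∂⁻¹(φ_jψ)` converges. -/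
structure IsLaxSolution (Ω : Set (ℝ × ℝ)) (n : ℕ) {N : ℕ} (α η : 𝕜)
    (u : ℝ → ℝ → 𝕜) (φ : Fin N → ℝ → ℝ → 𝕜) (mu : 𝕜) (ψ : ℝ → ℝ → 𝕜) : Prop where
  smooth : SmoothOn Ω ψ
  decay : ∀ j, DecaysOn Ω (fun x t => px (φ j) x t * ψ x t - φ j x t * px ψ x t)
  convergent : ∀ j, ∀ x t, (x, t) ∈ Ω → ∃ v, HasDInv (fun y s => φ j y s * ψ y s) x t v
  spectral : ∀ x t, (x, t) ∈ Ω → px (px ψ) x t + (mu + u x t) * ψ x t = 0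
  evolution : ∀ x t, (x, t) ∈ Ω →
    pt ψ x t = opA n u mu ψ x t + η * ψ x t + opB α φ ψ x t

/-- `ψ ↦ ψ_x - (f_x / f) ψ`. -/
def darboux (f ψ : ℝ → ℝ → 𝕜) : ℝ → ℝ → 𝕜 := fun x t =>
  px ψ x t - px f x t / f x t * ψ x t

/-- `u ↦ u + 2 ∂² ln f`, where `∂² ln f = ∂(f_x / f)`. -/
def darbouxPotential (f u : ℝ → ℝ → 𝕜) : ℝ → ℝ → 𝕜 := fun x t =>
  u x t + 2 * px (fun y s => px f y s / f y s) x t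

/-- `φ_j ↦ (φ_{j,x} - (f_x / f) φ_j) / r_j`, where `r_j` is a square root of `λ_j - ξ`. -/
def darbouxSource {N : ℕ} (r : Fin N → 𝕜) (f : ℝ → ℝ → 𝕜) (φ : Fin N → ℝ → ℝ → 𝕜) :
    Fin N → ℝ → ℝ → 𝕜 := fun j x t =>
  1 / r j * darboux f (φ j) x t

end KdVSources

end

open KdVSources

/-! Put v = f_x / f. The equation for f says u = -ξ - v_x - v², and then ū = -ξ + v_x - v². In
operator form ∂² + u + ξ = (∂ + v)(∂ - v) and ∂² + ū + ξ = (∂ - v)(∂ + v), so ψ̄ = (∂ - v)ψ solves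
the transformed spectral problem and (∂ + v)ψ̄ = -(μ - ξ)ψ. The functions ψ, ψ̄ thus form a first
order system in x.

Both potentials are differential polynomials in v, so the whole hierarchy can be compared inside
K[v, v_x, ...]. With D P = ½ P_xx - (v P)_x, the Lenard operators at u and ū are intertwined, which
gives b_{k+1}[ū] = b_{k+1}[u] + D(∑_{i ≤ k} ξ^{k-i} b_i[u]) (`bAt_miuraBar`). The generating sum
with parameter μ changes by D of its divided difference at μ and ξ (`bSum_miuraBar`).

The nonlocal terms become local along f: the Wronskian of φ_j and f is an antiderivative of (ξ -
λ_j) φ_j f that decays, so ∂⁻¹(φ_j f) = -φ̄_j f / r_j. Since (φ_j φ̄_j / r_j)_x = φ̄_j² - φ_j²,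
differentiating f_t / f in x gives v_t = -D(∑ ξ^{n+1-i} b_i[u]) - α ∑ (φ̄_j² - φ_j²) (`pt_dlog`).
Adding 2 v_xt to u_t yields the evolution of ū. The evolution of ψ̄ (`pt_darboux`) follows by
comparing the coefficients of ψ and ψ̄, together with ∂⁻¹(φ̄_j ψ̄) = r_j ∂⁻¹(φ_j ψ) + φ̄_j ψ. -/

namespace KdVSources

/-! ### Differential polynomials in v: the recursion at `miura` and `miuraBar` -/

section Algebra

open MvPolynomial

variable {K : Type*} [Field K]

/-- The total derivative on differential polynomials with coefficients in a field. -/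
noncomputable def totalDK (K : Type*) [Field K] :
    Derivation K (MvPolynomial ℕ K) (MvPolynomial ℕ K) :=
  mkDerivation K (fun i => X (i + 1))

@[simp] theorem totalDK_X (i : ℕ) : totalDK K (X i) = X (i + 1) := by simp [totalDK]

@[simp] theorem totalDK_C (a : K) : totalDK K (C a) = 0 := by simp [totalDK]

theorem totalDK_two : totalDK K 2 = 0 := by
  rw [← map_ofNat C 2, totalDK_C]

theorem totalDK_C_mul (a : K) (P : MvPolynomial ℕ K) :
    totalDK K (C a * P) = C a * totalDK K P := by
  simp [Derivation.leibniz]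

theorem totalDK_mul (P Q : MvPolynomial ℕ K) :
    totalDK K (P * Q) = totalDK K P * Q + P * totalDK K Q := by
  simp only [Derivation.leibniz, smul_eq_mul]; ring

theorem constantCoeff_totalDK (P : MvPolynomial ℕ K) : constantCoeff (totalDK K P) = 0 := by
  induction P using MvPolynomial.induction_on with
  | C a => simp
  | add p q hp hq => simp [hp, hq]
  | mul_X p i hp => simp [hp]

theorem totalDK_pderiv (m : ℕ) (P : MvPolynomial ℕ K) :
    pderiv (m + 1) (totalDK K P) = totalDK K (pderiv (m + 1) P) + pderiv m P := by
  classical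
  induction P using MvPolynomial.induction_on with
  | C a => simp
  | add p q hp hq => simp only [map_add, hp, hq]; ring
  | mul_X p i hp =>
    have h2 : ∀ j k : ℕ, pderiv j (X k : MvPolynomial ℕ K) = if k = j then 1 else 0 := by
      intro j k
      split_ifs with h
      · rw [h, pderiv_X_self]
      · exact pderiv_X_of_ne h
    have h3 : totalDK K (if i = m + 1 then (1 : MvPolynomial ℕ K) else 0) = 0 := by
      split_ifs <;> simp
    simp only [Derivation.leibniz, map_add, smul_eq_mul, totalDK_X, hp, h2, h3, add_left_inj]
    ring

/-- By `totalDK_pderiv`, a constant of the total derivative whose derivative in the variable m + 1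
vanishes also has vanishing derivative in the variable m. Only finitely many variables occur, so
descent kills every partial derivative, and characteristic zero leaves only the constant term. -/
theorem eq_zero_of_totalDK_eq_zero [CharZero K] {P : MvPolynomial ℕ K}
    (h0 : constantCoeff P = 0) (h : totalDK K P = 0) : P = 0 := by
  classical
  have step : ∀ m, pderiv (m + 1) P = 0 → pderiv m P = 0 := by
    intro m hm
    have := totalDK_pderiv m P
    rw [h, hm] at this
    simpa using this.symm
  obtain ⟨N, hN⟩ : ∃ N, ∀ m ∈ P.vars, m < N :=
    ⟨P.vars.sup id + 1, fun m hm => Nat.lt_succ_of_le (Finset.le_sup (f := id) hm)⟩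
  have all : ∀ m, pderiv m P = 0 := by
    intro m
    have big : ∀ k, N ≤ k → pderiv k P = 0 := fun k hk =>
      pderiv_eq_zero_of_notMem_vars fun hm => absurd (hN k hm) (by omega)
    have : ∀ k, pderiv (m + k) P = 0 → pderiv m P = 0 := by
      intro k
      induction k with
      | zero => exact id
      | succ k ih => exact fun hk => ih (step _ hk)
    exact this N (big _ (by omega))
  ext d
  rw [coeff_zero]
  by_cases hd : d = 0
  · subst hd; exact h0
  · obtain ⟨i, hi⟩ : ∃ i, d i ≠ 0 := by
      by_contra hcon
      push Not at hcon
      exact hd (Finsupp.ext hcon)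
    have hle : Finsupp.single i 1 ≤ d := by
      rw [Finsupp.single_le_iff]; omega
    have := coeff_pderiv P (i := i) (d - Finsupp.single i 1)
    rw [all i, coeff_zero, tsub_add_cancel_of_le hle] at this
    rcases mul_eq_zero.mp this.symm with h' | h'
    · exact h'
    · exact absurd h' (Nat.cast_add_one_ne_zero _)

/-- The operator `∂ L` with potential `U`. -/
noncomputable def lenardK (U P : MvPolynomial ℕ K) : MvPolynomial ℕ K :=
  -(C (1 / 4) * totalDK K (totalDK K (totalDK K P))) - U * totalDK K P
    - C (1 / 2) * (totalDK K U * P)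

theorem lenardK_add (U P Q : MvPolynomial ℕ K) :
    lenardK U (P + Q) = lenardK U P + lenardK U Q := by
  simp only [lenardK, map_add]; ring

theorem lenardK_C_mul (a : K) (U P : MvPolynomial ℕ K) :
    lenardK U (C a * P) = C a * lenardK U P := by
  simp only [lenardK, totalDK_C_mul]; ring

/-- The potential `-ξ - v_x - v²`, which has `v = (ln f)_x` with `f_xx + (ξ + u) f = 0`. -/
noncomputable def miura (ξ : K) : MvPolynomial ℕ K := -C ξ - X 1 - X 0 ^ 2

/-- The Darboux transform `-ξ + v_x - v²` of `miura ξ`. -/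
noncomputable def miuraBar (ξ : K) : MvPolynomial ℕ K := -C ξ + X 1 - X 0 ^ 2

theorem totalDK_miura (ξ : K) : totalDK K (miura ξ) = -X 2 - 2 * X 0 * X 1 := by
  simp only [miura, map_sub, map_neg, totalDK_C, totalDK_X, pow_two, totalDK_mul]; ring

theorem totalDK_miuraBar (ξ : K) : totalDK K (miuraBar ξ) = X 2 - 2 * X 0 * X 1 := by
  simp only [miuraBar, map_add, map_sub, map_neg, totalDK_C, totalDK_X, pow_two, totalDK_mul]; ring

/-- The operator `P ↦ ½ P_xx - (v P)_x`. -/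
noncomputable def darbouxShift (P : MvPolynomial ℕ K) : MvPolynomial ℕ K :=
  C (1 / 2) * totalDK K (totalDK K P) - totalDK K (X 0 * P)

theorem darbouxShift_add (P Q : MvPolynomial ℕ K) :
    darbouxShift (P + Q) = darbouxShift P + darbouxShift Q := by
  simp only [darbouxShift, mul_add, map_add]; ring

theorem darbouxShift_C_mul (a : K) (P : MvPolynomial ℕ K) :
    darbouxShift (C a * P) = C a * darbouxShift P := by
  simp only [darbouxShift, mul_left_comm _ (C a), totalDK_C_mul]; ring

theorem constantCoeff_darbouxShift (P : MvPolynomial ℕ K) :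
    constantCoeff (darbouxShift P) = 0 := by
  simp [darbouxShift, constantCoeff_totalDK]

variable [CharZero K]

/-- Substitution of `U` and its total derivatives for `u` and its derivatives. -/
noncomputable def substDP (U : MvPolynomial ℕ K) : DiffPoly →ₐ[ℚ] MvPolynomial ℕ K :=
  aeval (fun i => (totalDK K)^[i] U)

theorem substDP_X (U : MvPolynomial ℕ K) (i : ℕ) :
    substDP U (X i) = (totalDK K)^[i] U := by simp [substDP]

theorem totalDK_rat_smul (q : ℚ) (P : MvPolynomial ℕ K) :
    totalDK K (q • P) = q • totalDK K P := by
  have h : ∀ Q : MvPolynomial ℕ K, q • Q = (q : K) • Q := fun Q => by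
    ext d; simp [Rat.smul_def]
  rw [h, h, Derivation.map_smul]

theorem substDP_totalD (U : MvPolynomial ℕ K) (P : DiffPoly) :
    substDP U (totalD P) = totalDK K (substDP U P) := by
  induction P using MvPolynomial.induction_on with
  | C a =>
    have h : (C a : DiffPoly) = a • 1 := by rw [smul_eq_C_mul, mul_one]
    rw [h, Derivation.map_smul, map_smul, map_smul, totalDK_rat_smul]; simp
  | add p q hp hq => simp [hp, hq]
  | mul_X p i hp =>
    have h1 : totalD (X i) = X (i + 1) := by simp [totalD]
    simp only [Derivation.leibniz, smul_eq_mul, map_add, map_mul, hp, h1, substDP_X,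
      Function.iterate_succ_apply']

theorem substDP_lenard (U : MvPolynomial ℕ K) (P : DiffPoly) :
    substDP U (lenard P) = lenardK U (substDP U P) := by
  have h : ∀ (q : ℚ) (Q : MvPolynomial ℕ K), q • Q = C (q : K) * Q := fun q Q => by
    ext d; simp [Rat.smul_def]
  simp only [lenard, lenardK, map_sub, map_neg, map_smul, map_mul, substDP_totalD, substDP_X,
    Function.iterate_zero, Function.iterate_one, id, h]
  norm_num

/-- The differential polynomial `b_k` at the potential `U`. -/
noncomputable def bAt (U : MvPolynomial ℕ K) (k : ℕ) : MvPolynomial ℕ K := substDP U (bPoly k)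

@[simp] theorem bAt_zero (U : MvPolynomial ℕ K) : bAt U 0 = 0 := by simp [bAt, bPoly]

@[simp] theorem bAt_one (U : MvPolynomial ℕ K) : bAt U 1 = 1 := by simp [bAt, bPoly]

theorem totalDK_bAt_succ (U : MvPolynomial ℕ K) (k : ℕ) :
    totalDK K (bAt U (k + 1)) = lenardK U (bAt U k) := by
  cases k with
  | zero => simp [lenardK]
  | succ k => rw [bAt, ← substDP_totalD, totalD_bPoly_succ, substDP_lenard, bAt]

/-- The truncated generating polynomial `∑_{i ≤ k} μ^{k-i} b_i[U]`. -/
noncomputable def bSum (U : MvPolynomial ℕ K) (μ : K) : ℕ → MvPolynomial ℕ K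
  | 0 => 0
  | k + 1 => C μ * bSum U μ k + bAt U (k + 1)

/-- The sum telescopes: the operator sends b_i to ∂ b_{i+1}, so it shifts the index, and only the
new top term fails to carry a factor μ. -/
theorem lenardK_bSum (U : MvPolynomial ℕ K) (μ : K) (k : ℕ) :
    lenardK U (bSum U μ k) = totalDK K (bAt U (k + 1)) + C μ * totalDK K (bSum U μ k) := by
  induction k with
  | zero => simp [bSum, lenardK]
  | succ k ih =>
    rw [bSum, lenardK_add, lenardK_C_mul, ih, ← totalDK_bAt_succ, map_add, totalDK_C_mul]
    ring

/-- The divided difference of `bSum` at `μ` and `ξ`. -/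
noncomputable def bDiff (U : MvPolynomial ℕ K) (ξ μ : K) : ℕ → MvPolynomial ℕ K
  | 0 => 0
  | k + 1 => C μ * bDiff U ξ μ k + bSum U ξ k

/-- `bDiff` is defined by recursion rather than by division, so it retains a meaning at μ = ξ. -/
theorem sub_mul_bDiff (U : MvPolynomial ℕ K) (ξ μ : K) (k : ℕ) :
    (C μ - C ξ) * bDiff U ξ μ k = bSum U μ k - bSum U ξ k := by
  induction k with
  | zero => simp [bSum, bDiff]
  | succ k ih => rw [bDiff, bSum, bSum]; linear_combination C μ * ih

/-- For μ ≠ ξ this is the difference of `lenardK_bSum` at μ and at ξ, divided by μ - ξ; the term ∂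
b_{k+1} cancels. The induction covers μ = ξ as well. -/
theorem lenardK_bDiff (U : MvPolynomial ℕ K) (ξ μ : K) (k : ℕ) :
    lenardK U (bDiff U ξ μ k) = totalDK K (bSum U μ k) + C ξ * totalDK K (bDiff U ξ μ k) := by
  induction k with
  | zero => simp [bDiff, bSum, lenardK]
  | succ k ih =>
    rw [bDiff, lenardK_add, lenardK_C_mul, ih, lenardK_bSum, bSum]
    simp only [map_add, totalDK_C_mul]
    ring

/-- Both potentials have constant term -ξ, and all their total derivatives have none. This fixes the
integration constant in `bAt_miuraBar`. -/
theorem constantCoeff_substDP_miura (ξ : K) (P : DiffPoly) :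
    constantCoeff (substDP (miura ξ) P) = constantCoeff (substDP (miuraBar ξ) P) := by
  induction P using MvPolynomial.induction_on with
  | C a =>
    have h : (C a : DiffPoly) = a • 1 := by rw [smul_eq_C_mul, mul_one]
    rw [h, map_smul (substDP (miura ξ)), map_smul (substDP (miuraBar ξ)), map_one, map_one]
  | add p q hp hq => simp [hp, hq]
  | mul_X p i hp =>
    rw [map_mul, map_mul, map_mul, map_mul, hp, substDP_X, substDP_X]
    cases i with
    | zero => simp [miura, miuraBar]
    | succ i =>
      rw [Function.iterate_succ_apply', Function.iterate_succ_apply', constantCoeff_totalDK,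
        constantCoeff_totalDK]

theorem C_half : (C (1 / 2 : K) : MvPolynomial ℕ K) = 2 * C (1 / 4) := by
  rw [← map_ofNat C 2, ← map_mul]; norm_num

theorem four_mul_C_quarter : (4 : MvPolynomial ℕ K) * C (1 / 4 : K) = 1 := by
  rw [← map_ofNat C 4, ← map_mul]; norm_num

/-- The Lenard operators at a potential and at its Darboux transform are intertwined. -/
theorem lenardK_miuraBar_darbouxShift (ξ : K) (B c : MvPolynomial ℕ K)
    (h : lenardK (miura ξ) B = totalDK K c + C ξ * totalDK K B) :
    lenardK (miuraBar ξ) (c + darbouxShift B)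
      = lenardK (miura ξ) c + totalDK K (darbouxShift (C ξ * B + c)) := by
  -- Eliminating the derivatives of c turns the claim into a polynomial identity in c and the
  -- derivatives of v and B, modulo 4 · ¼ = 1.
  have h1 : totalDK K c = lenardK (miura ξ) B - C ξ * totalDK K B := by rw [h]; ring
  have e2 := four_mul_C_quarter (K := K)
  rw [darbouxShift_add, darbouxShift_C_mul]
  simp only [lenardK, totalDK_miura, totalDK_miuraBar] at h1 ⊢
  simp only [darbouxShift, map_add, map_sub, map_neg, totalDK_mul, totalDK_X, h1,
    miura, miuraBar, pow_two, totalDK_C, C_half, totalDK_two, map_zero, zero_mul,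
    mul_zero, zero_add, add_zero]
  generalize C (1 / 4 : K) = q at *
  generalize C ξ = x at *
  clear h
  grind

/-- The two sides have equal total derivatives by the intertwining relation, applied with B the sum
at ξ and c = b_{k+1}, and equal constant terms. -/
theorem bAt_miuraBar (ξ : K) (k : ℕ) :
    bAt (miuraBar ξ) (k + 1) = bAt (miura ξ) (k + 1) + darbouxShift (bSum (miura ξ) ξ k) := by
  induction k with
  | zero => simp [bSum, darbouxShift]
  | succ k ih =>
    rw [← sub_eq_zero]
    apply eq_zero_of_totalDK_eq_zero
    · simp only [map_sub, map_add, constantCoeff_darbouxShift, bAt, constantCoeff_substDP_miura]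
      ring
    · rw [map_sub, totalDK_bAt_succ, ih,
        lenardK_miuraBar_darbouxShift ξ _ _ (lenardK_bSum _ ξ k), map_add, totalDK_bAt_succ, bSum]
      ring

/-- `bAt_miuraBar` is summed along the Horner recursion; the corrections, sums at ξ weighted by
powers of μ, build up exactly `bDiff`. -/
theorem bSum_miuraBar (ξ μ : K) (k : ℕ) :
    bSum (miuraBar ξ) μ k = bSum (miura ξ) μ k + darbouxShift (bDiff (miura ξ) ξ μ k) := by
  induction k with
  | zero => simp [bSum, bDiff, darbouxShift]
  | succ k ih =>
    rw [bSum, bSum, bDiff, ih, bAt_miuraBar, darbouxShift_add, darbouxShift_C_mul]; ring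

/-- The coefficient of the transformed wave function. -/
theorem bSum_miuraBar_coeff (ξ μ : K) (k : ℕ) :
    C (1 / 2) * totalDK K (bSum (miura ξ) μ k) - bSum (miura ξ) μ k * X 0
      = -(C (1 / 2) * totalDK K (bSum (miuraBar ξ) μ k)) - X 0 * bSum (miuraBar ξ) μ k := by
  -- With P the divided difference and S the sum at μ, the claim reads S_x + ½ (D P)_x + v D P = 0,
  -- which is this relation with the potential written in v.
  have h := lenardK_bDiff (miura ξ) ξ μ k
  have e2 := four_mul_C_quarter (K := K)
  rw [bSum_miuraBar]
  generalize bDiff (miura ξ) ξ μ k = P at *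
  generalize bSum (miura ξ) μ k = S at *
  simp only [lenardK, totalDK_miura] at h
  simp only [darbouxShift, map_add, map_sub, totalDK_mul, totalDK_X,
    miura, pow_two, totalDK_C, C_half, totalDK_two, zero_mul,
    mul_zero, zero_add, add_zero] at h ⊢
  generalize C (1 / 4 : K) = q at *
  generalize C ξ = x at *
  grind

end Algebra

end KdVSources

/-! ### Calculus on Ω: partial derivatives, evaluation, improper integrals -/

namespace KdVSources

section Analysis

variable {𝕜 : Type*} [RCLike 𝕜] {Ω : Set (ℝ × ℝ)} {g h : ℝ → ℝ → 𝕜} {x t : ℝ}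

theorem hasDerivAt_mk_left (x t : ℝ) : HasDerivAt (fun y : ℝ => (y, t)) ((1, 0) : ℝ × ℝ) x :=
  (hasDerivAt_id x).prodMk (hasDerivAt_const x t)

theorem hasDerivAt_mk_right (x t : ℝ) : HasDerivAt (fun s : ℝ => (x, s)) ((0, 1) : ℝ × ℝ) t :=
  (hasDerivAt_const t x).prodMk (hasDerivAt_id t)

theorem hasDerivAt_left_of_hasFDerivAt {E : Type*} [NormedAddCommGroup E] [NormedSpace ℝ E]
    {G : ℝ × ℝ → E} {G' : ℝ × ℝ →L[ℝ] E} (hG : HasFDerivAt G G' (x, t)) :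
    HasDerivAt (fun y => G (y, t)) (G' (1, 0)) x :=
  hG.comp_hasDerivAt x (hasDerivAt_mk_left x t)

theorem hasDerivAt_right_of_hasFDerivAt {E : Type*} [NormedAddCommGroup E] [NormedSpace ℝ E]
    {G : ℝ × ℝ → E} {G' : ℝ × ℝ →L[ℝ] E} (hG : HasFDerivAt G G' (x, t)) :
    HasDerivAt (fun s => G (x, s)) (G' (0, 1)) t :=
  hG.comp_hasDerivAt t (hasDerivAt_mk_right x t)

theorem two_le_infty : (2 : WithTop ℕ∞) ≤ ∞ := by
  have : ((2 : ℕ∞) : WithTop ℕ∞) ≤ ((⊤ : ℕ∞) : WithTop ℕ∞) := WithTop.coe_le_coe.2 le_top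
  exact this

theorem SmoothOn.hasFDerivAt (hg : SmoothOn Ω g) (hΩ : IsOpen Ω) (hx : (x, t) ∈ Ω) :
    HasFDerivAt (fun p : ℝ × ℝ => g p.1 p.2)
      (fderiv ℝ (fun p : ℝ × ℝ => g p.1 p.2) (x, t)) (x, t) :=
  ((hg.contDiffAt (hΩ.mem_nhds hx)).differentiableAt (by simp)).hasFDerivAt

theorem SmoothOn.px_eq (hg : SmoothOn Ω g) (hΩ : IsOpen Ω) (hx : (x, t) ∈ Ω) :
    px g x t = fderiv ℝ (fun p : ℝ × ℝ => g p.1 p.2) (x, t) (1, 0) :=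
  (hasDerivAt_left_of_hasFDerivAt (hg.hasFDerivAt hΩ hx)).deriv

theorem SmoothOn.pt_eq (hg : SmoothOn Ω g) (hΩ : IsOpen Ω) (hx : (x, t) ∈ Ω) :
    pt g x t = fderiv ℝ (fun p : ℝ × ℝ => g p.1 p.2) (x, t) (0, 1) :=
  (hasDerivAt_right_of_hasFDerivAt (hg.hasFDerivAt hΩ hx)).deriv

theorem SmoothOn.hasDerivAt_px (hg : SmoothOn Ω g) (hΩ : IsOpen Ω) (hx : (x, t) ∈ Ω) :
    HasDerivAt (fun y => g y t) (px g x t) x := by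
  rw [hg.px_eq hΩ hx]
  exact hasDerivAt_left_of_hasFDerivAt (hg.hasFDerivAt hΩ hx)

theorem SmoothOn.hasDerivAt_pt (hg : SmoothOn Ω g) (hΩ : IsOpen Ω) (hx : (x, t) ∈ Ω) :
    HasDerivAt (fun s => g x s) (pt g x t) t := by
  rw [hg.pt_eq hΩ hx]
  exact hasDerivAt_right_of_hasFDerivAt (hg.hasFDerivAt hΩ hx)

theorem SmoothOn.fderiv_apply (hg : SmoothOn Ω g) (hΩ : IsOpen Ω) (w : ℝ × ℝ) :
    SmoothOn Ω (fun x t => fderiv ℝ (fun p : ℝ × ℝ => g p.1 p.2) (x, t) w) :=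
  ContDiffOn.clm_apply (hg.fderiv_of_isOpen hΩ (by simp)) contDiffOn_const

theorem SmoothOn.congr (hg : SmoothOn Ω g) (he : ∀ x t, (x, t) ∈ Ω → h x t = g x t) :
    SmoothOn Ω h :=
  ContDiffOn.congr hg fun p hp => he p.1 p.2 hp

theorem SmoothOn.px (hg : SmoothOn Ω g) (hΩ : IsOpen Ω) : SmoothOn Ω (px g) :=
  (hg.fderiv_apply hΩ (1, 0)).congr fun _ _ hx => hg.px_eq hΩ hx

theorem SmoothOn.iterate_px (hg : SmoothOn Ω g) (hΩ : IsOpen Ω) (i : ℕ) :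
    SmoothOn Ω (KdVSources.px^[i] g) := by
  induction i with
  | zero => exact hg
  | succ i ih => rw [Function.iterate_succ_apply']; exact ih.px hΩ

theorem SmoothOn.add (hg : SmoothOn Ω g) (hh : SmoothOn Ω h) :
    SmoothOn Ω (fun x t => g x t + h x t) := ContDiffOn.add hg hh

theorem SmoothOn.sub (hg : SmoothOn Ω g) (hh : SmoothOn Ω h) :
    SmoothOn Ω (fun x t => g x t - h x t) := ContDiffOn.sub hg hh

theorem SmoothOn.mul (hg : SmoothOn Ω g) (hh : SmoothOn Ω h) :
    SmoothOn Ω (fun x t => g x t * h x t) := ContDiffOn.mul hg hh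

theorem SmoothOn.const_mul (hg : SmoothOn Ω g) (c : 𝕜) :
    SmoothOn Ω (fun x t => c * g x t) := ContDiffOn.mul contDiffOn_const hg

theorem SmoothOn.div (hg : SmoothOn Ω g) (hh : SmoothOn Ω h)
    (h0 : ∀ x t, (x, t) ∈ Ω → h x t ≠ 0) : SmoothOn Ω (fun x t => g x t / h x t) := by
  simp only [div_eq_mul_inv]
  exact ContDiffOn.mul hg (ContDiffOn.inv hh fun p hp => h0 p.1 p.2 hp)

theorem eventually_left (hΩ : IsOpen Ω) (hx : (x, t) ∈ Ω) : ∀ᶠ y in 𝓝 x, (y, t) ∈ Ω :=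
  (hasDerivAt_mk_left x t).continuousAt.eventually_mem (hΩ.mem_nhds hx)

theorem eventually_right (hΩ : IsOpen Ω) (hx : (x, t) ∈ Ω) : ∀ᶠ s in 𝓝 t, (x, s) ∈ Ω :=
  (hasDerivAt_mk_right x t).continuousAt.eventually_mem (hΩ.mem_nhds hx)

theorem px_congr (hΩ : IsOpen Ω) (he : ∀ x t, (x, t) ∈ Ω → g x t = h x t) (hx : (x, t) ∈ Ω) :
    px g x t = px h x t :=
  Filter.EventuallyEq.deriv_eq ((eventually_left hΩ hx).mono fun y hy => he y t hy)

theorem pt_congr (hΩ : IsOpen Ω) (he : ∀ x t, (x, t) ∈ Ω → g x t = h x t) (hx : (x, t) ∈ Ω) :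
    pt g x t = pt h x t :=
  Filter.EventuallyEq.deriv_eq ((eventually_right hΩ hx).mono fun y hy => he x y hy)

theorem SmoothOn.pt_px (hg : SmoothOn Ω g) (hΩ : IsOpen Ω) (hx : (x, t) ∈ Ω) :
    KdVSources.pt (KdVSources.px g) x t = KdVSources.px (KdVSources.pt g) x t := by
  have hd : HasFDerivAt (fderiv ℝ (fun p : ℝ × ℝ => g p.1 p.2))
      (fderiv ℝ (fderiv ℝ (fun p : ℝ × ℝ => g p.1 p.2)) (x, t)) (x, t) :=
    (((hg.fderiv_of_isOpen hΩ (m := 1) (by rw [one_add_one_eq_two]; exact two_le_infty)).contDiffAt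
      (hΩ.mem_nhds hx)).differentiableAt one_ne_zero).hasFDerivAt
  have hsym : IsSymmSndFDerivAt ℝ (fun p : ℝ × ℝ => g p.1 p.2) (x, t) :=
    (hg.contDiffAt (hΩ.mem_nhds hx)).isSymmSndFDerivAt
      (by rw [minSmoothness_of_isRCLikeNormedField]; exact two_le_infty)
  have e1 : KdVSources.pt (KdVSources.px g) x t
      = fderiv ℝ (fderiv ℝ (fun p : ℝ × ℝ => g p.1 p.2)) (x, t) (0, 1) (1, 0) := by
    rw [pt_congr hΩ (fun _ _ h => hg.px_eq hΩ h) hx]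
    have := (hasDerivAt_right_of_hasFDerivAt hd).clm_apply
      (hasDerivAt_const t ((1, 0) : ℝ × ℝ))
    exact this.deriv.trans (by simp)
  have e2 : KdVSources.px (KdVSources.pt g) x t
      = fderiv ℝ (fderiv ℝ (fun p : ℝ × ℝ => g p.1 p.2)) (x, t) (1, 0) (0, 1) := by
    rw [px_congr hΩ (fun _ _ h => hg.pt_eq hΩ h) hx]
    have := (hasDerivAt_left_of_hasFDerivAt hd).clm_apply
      (hasDerivAt_const x ((0, 1) : ℝ × ℝ))
    exact this.deriv.trans (by simp)
  rw [e1, e2]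
  exact hsym.eq _ _

/-! ### Differential polynomials in `v` as functions -/

/-- The value of a differential polynomial with coefficients in `𝕜` on a function `v(x, t)`. -/
noncomputable def evalDK (v : ℝ → ℝ → 𝕜) (x t : ℝ) : MvPolynomial ℕ 𝕜 →ₐ[𝕜] 𝕜 :=
  MvPolynomial.aeval (fun i => (px^[i] v) x t)

@[simp] theorem evalDK_X (v : ℝ → ℝ → 𝕜) (x t : ℝ) (i : ℕ) :
    evalDK v x t (MvPolynomial.X i) = (px^[i] v) x t := by simp [evalDK]

@[simp] theorem evalDK_C (v : ℝ → ℝ → 𝕜) (x t : ℝ) (a : 𝕜) :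
    evalDK v x t (MvPolynomial.C a) = a := by simp [evalDK]

theorem hasDerivAt_evalDK {v : ℝ → ℝ → 𝕜} (hv : SmoothOn Ω v) (hΩ : IsOpen Ω)
    (hx : (x, t) ∈ Ω) (Q : MvPolynomial ℕ 𝕜) :
    HasDerivAt (fun y => evalDK v y t Q) (evalDK v x t (totalDK 𝕜 Q)) x := by
  induction Q using MvPolynomial.induction_on with
  | C a => simpa using hasDerivAt_const x a
  | add p q hp hq => simpa only [map_add] using HasDerivAt.fun_add hp hq
  | mul_X p i hp =>
    have hX := (hv.iterate_px hΩ i).hasDerivAt_px hΩ hx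
    simp only [map_mul, totalDK_mul, map_add, totalDK_X, evalDK_X,
      Function.iterate_succ_apply']
    exact hp.mul hX

/-- Both sides are ℚ-algebra homomorphisms in P, so it suffices to compare generators. There the
chain rule applies at each order; equality on all of the open set Ω is what permits differentiating
again. -/
theorem evalDP_eq_evalDK {v w : ℝ → ℝ → 𝕜} (hv : SmoothOn Ω v) (hΩ : IsOpen Ω)
    {U : MvPolynomial ℕ 𝕜} (hw : ∀ x t, (x, t) ∈ Ω → w x t = evalDK v x t U)
    (P : DiffPoly) (hx : (x, t) ∈ Ω) :
    evalDP P w x t = evalDK v x t (substDP U P) := by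
  have key : ∀ i x t, (x, t) ∈ Ω → (px^[i] w) x t = evalDK v x t ((totalDK 𝕜)^[i] U) := by
    intro i
    induction i with
    | zero => exact hw
    | succ i ih =>
      intro x t hx
      rw [Function.iterate_succ_apply', Function.iterate_succ_apply', px_congr hΩ ih hx]
      exact (hasDerivAt_evalDK hv hΩ hx _).deriv
  have : (MvPolynomial.aeval (fun i => (px^[i] w) x t) : DiffPoly →ₐ[ℚ] 𝕜)
      = ((evalDK v x t).restrictScalars ℚ).comp (substDP U) := by
    ext i
    simp [substDP_X, key i x t hx]
  exact congrArg (fun F : DiffPoly →ₐ[ℚ] 𝕜 => F P) this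

/-- `A⁽ⁿ⁾ψ = -½ (∂b) ψ + b ψ_x` with `b = ∑_i λ^{n+1-i} b_i`. -/
theorem opA_eq_evalDK {v w : ℝ → ℝ → 𝕜} (hv : SmoothOn Ω v) (hΩ : IsOpen Ω)
    {U : MvPolynomial ℕ 𝕜} (hw : ∀ x t, (x, t) ∈ Ω → w x t = evalDK v x t U)
    (n : ℕ) (μ : 𝕜) (ψ : ℝ → ℝ → 𝕜) (hx : (x, t) ∈ Ω) :
    opA n w μ ψ x t = -(1 / 2 * evalDK v x t (totalDK 𝕜 (bSum U μ (n + 1)))) * ψ x t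
      + evalDK v x t (bSum U μ (n + 1)) * px ψ x t := by
  have hb : ∀ i, evalDP (bPoly i) w x t = evalDK v x t (bAt U i) := fun i =>
    evalDP_eq_evalDK hv hΩ hw _ hx
  have ha : ∀ i, evalDP (aPoly i) w x t = -(1 / 2 * evalDK v x t (totalDK 𝕜 (bAt U i))) := by
    intro i
    rw [evalDP_eq_evalDK hv hΩ hw _ hx, aPoly, map_neg, map_smul, substDP_totalD, bAt, map_neg,
      ← AlgHom.restrictScalars_apply ℚ, map_smul]
    simp [Rat.smul_def]
  -- The sum is the Horner scheme that defines `bSum`; its term i = 0 vanishes because b_0 = 0.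
  suffices H : ∀ k, ∑ i ∈ Finset.range (k + 1),
      (evalDP (aPoly i) w x t * ψ x t + evalDP (bPoly i) w x t * px ψ x t) * μ ^ (k - i)
      = -(1 / 2 * evalDK v x t (totalDK 𝕜 (bSum U μ k))) * ψ x t
        + evalDK v x t (bSum U μ k) * px ψ x t from H (n + 1)
  intro k
  induction k with
  | zero => simp [ha, hb, bSum]
  | succ k ih =>
    have : ∀ i ∈ Finset.range (k + 1),
        (evalDP (aPoly i) w x t * ψ x t + evalDP (bPoly i) w x t * px ψ x t) * μ ^ (k + 1 - i)
        = μ * ((evalDP (aPoly i) w x t * ψ x t + evalDP (bPoly i) w x t * px ψ x t)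
          * μ ^ (k - i)) := by
      intro i hi
      rw [Nat.succ_sub (Nat.lt_succ_iff.mp (Finset.mem_range.mp hi)), pow_succ]
      ring
    rw [Finset.sum_range_succ, Finset.sum_congr rfl this, ← Finset.mul_sum, ih, ha, hb, bSum]
    simp only [map_add, totalDK_C_mul, map_mul, evalDK_C, Nat.sub_self, pow_zero]
    ring

/-! ### The inverse `∂⁻¹` on functions -/

theorem HasDInv.dInv_eq {v : 𝕜} (h : HasDInv g x t v) : dInv g x t = v := h.limUnder_eq

theorem LeftDomain.uIcc_subset (hΩ : LeftDomain Ω) {a b y : ℝ} (ha : (a, t) ∈ Ω)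
    (hb : (b, t) ∈ Ω) (hy : y ∈ Set.uIcc a b) : (y, t) ∈ Ω := by
  rcases le_total a b with hab | hab
  · rw [Set.uIcc_of_le hab] at hy; exact hΩ.2 _ _ _ hb hy.2
  · rw [Set.uIcc_of_ge hab] at hy; exact hΩ.2 _ _ _ ha hy.2

theorem SmoothOn.intervalIntegrable (hg : SmoothOn Ω g) (hΩ : LeftDomain Ω) {a b : ℝ}
    (ha : (a, t) ∈ Ω) (hb : (b, t) ∈ Ω) :
    IntervalIntegrable (fun y => g y t) MeasureTheory.volume a b :=
  ContinuousOn.intervalIntegrable fun _ hy =>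
    (hg.hasDerivAt_px hΩ.1 (hΩ.uIcc_subset ha hb hy)).continuousAt.continuousWithinAt

/-- An antiderivative that tends to `0` at `-∞` computes `∂⁻¹`. -/
theorem hasDInv_of_hasDerivAt (hg : SmoothOn Ω g) (hΩ : LeftDomain Ω) {G : ℝ → 𝕜}
    (hx : (x, t) ∈ Ω) (hG : ∀ y, (y, t) ∈ Ω → HasDerivAt G (g y t) y)
    (h0 : Filter.Tendsto G Filter.atBot (𝓝 0)) : HasDInv g x t (G x) := by
  have h1 : Filter.Tendsto (fun a => G x - G a) Filter.atBot (𝓝 (G x)) := by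
    simpa using h0.const_sub (G x)
  refine h1.congr' ?_
  filter_upwards [Filter.eventually_le_atBot x] with a ha
  have ha' := hΩ.2 _ _ _ hx ha
  exact (intervalIntegral.integral_eq_sub_of_hasDerivAt
    (fun y hy => hG y (hΩ.uIcc_subset ha' hx hy)) (hg.intervalIntegrable hΩ ha' hx)).symm

/-- Convergence at a single point of a time slice gives convergence at every point of that slice,
since the slice is an interval unbounded to the left. -/
theorem dInv_eq_add_integral (hg : SmoothOn Ω g) (hΩ : LeftDomain Ω) {y : ℝ}
    (hx : (x, t) ∈ Ω) (hy : (y, t) ∈ Ω) {v : 𝕜} (hv : HasDInv g x t v) :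
    dInv g y t = v + ∫ z in x..y, g z t := by
  apply HasDInv.dInv_eq
  refine (hv.add_const (∫ z in x..y, g z t)).congr' ?_
  filter_upwards [Filter.eventually_le_atBot x] with a ha
  have ha' := hΩ.2 _ _ _ hx ha
  exact intervalIntegral.integral_add_adjacent_intervals (hg.intervalIntegrable hΩ ha' hx)
    (hg.intervalIntegrable hΩ hx hy)

theorem hasDerivAt_dInv (hg : SmoothOn Ω g) (hΩ : LeftDomain Ω) (hx : (x, t) ∈ Ω)
    (hv : ∃ v, HasDInv g x t v) : HasDerivAt (fun y => dInv g y t) (g x t) x := by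
  obtain ⟨v, hv⟩ := hv
  have hc : ∀ᶠ y in 𝓝 x, ContinuousAt (fun y => g y t) y :=
    (eventually_left hΩ.1 hx).mono fun y hy => (hg.hasDerivAt_px hΩ.1 hy).continuousAt
  have hm : StronglyMeasurableAtFilter (fun y => g y t) (𝓝 x) :=
    ContinuousOn.stronglyMeasurableAtFilter_nhdsWithin
      (s := {y | (y, t) ∈ Ω}) (fun y hy =>
        (hg.hasDerivAt_px hΩ.1 hy).continuousAt.continuousWithinAt)
      (hΩ.1.preimage (by fun_prop : Continuous fun y : ℝ => (y, t))).measurableSet x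
      |>.filter_mono 
        ((hΩ.1.preimage (by fun_prop : Continuous fun y : ℝ => (y, t))).nhdsWithin_eq hx).ge
  have h1 := (intervalIntegral.integral_hasDerivAt_right (hg.intervalIntegrable hΩ hx hx) hm
    hc.self_of_nhds).const_add v
  refine h1.congr_of_eventuallyEq ?_
  filter_upwards [eventually_left hΩ.1 hx] with y hy
  exact dInv_eq_add_integral hg hΩ hx hy hv

/-- The tail of a convergent improper integral tends to zero. -/
theorem tendsto_dInv (hg : SmoothOn Ω g) (hΩ : LeftDomain Ω) (hx : (x, t) ∈ Ω)
    (hv : ∃ v, HasDInv g x t v) :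
    Filter.Tendsto (fun y => dInv g y t) Filter.atBot (𝓝 0) := by
  obtain ⟨v, hv⟩ := hv
  have h1 : Filter.Tendsto (fun a => v - ∫ z in a..x, g z t) Filter.atBot (𝓝 0) := by
    simpa using Filter.Tendsto.const_sub v hv
  refine h1.congr' ?_
  filter_upwards [Filter.eventually_le_atBot x] with a ha
  rw [dInv_eq_add_integral hg hΩ hx (hΩ.2 _ _ _ hx ha) hv, intervalIntegral.integral_symm]
  ring

end Analysis

end KdVSources

/-! ### The Darboux transformation of the spectral problem -/

namespace KdVSources

section Darboux

variable {𝕜 : Type*} [RCLike 𝕜] {Ω : Set (ℝ × ℝ)} {x t : ℝ}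

/-- The logarithmic derivative `f_x / f`. -/
noncomputable def dlog (f : ℝ → ℝ → 𝕜) : ℝ → ℝ → 𝕜 := fun x t => px f x t / f x t

theorem smoothOn_dlog {f : ℝ → ℝ → 𝕜} (hf : SmoothOn Ω f) (hΩ : IsOpen Ω)
    (hf0 : ∀ x t, (x, t) ∈ Ω → f x t ≠ 0) : SmoothOn Ω (dlog f) :=
  (hf.px hΩ).div hf hf0

theorem smoothOn_darboux {f ψ : ℝ → ℝ → 𝕜} (hf : SmoothOn Ω f) (hΩ : IsOpen Ω)
    (hf0 : ∀ x t, (x, t) ∈ Ω → f x t ≠ 0) (hψ : SmoothOn Ω ψ) : SmoothOn Ω (darboux f ψ) :=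
  (hψ.px hΩ).sub ((smoothOn_dlog hf hΩ hf0).mul hψ)

theorem px_eq_mul_dlog {f : ℝ → ℝ → 𝕜} (h0 : f x t ≠ 0) : px f x t = dlog f x t * f x t := by
  rw [dlog, div_mul_cancel₀ _ h0]

/-- The Riccati equation for `f_x / f`. -/
theorem px_dlog {f u : ℝ → ℝ → 𝕜} {ξ : 𝕜} (hf : SmoothOn Ω f) (hΩ : IsOpen Ω)
    (hf0 : ∀ x t, (x, t) ∈ Ω → f x t ≠ 0)
    (hs : ∀ x t, (x, t) ∈ Ω → px (px f) x t + (ξ + u x t) * f x t = 0) (hx : (x, t) ∈ Ω) :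
    px (dlog f) x t = -ξ - u x t - dlog f x t ^ 2 := by
  have h0 := hf0 x t hx
  have h1 := ((hf.px hΩ).hasDerivAt_px hΩ hx).fun_div (hf.hasDerivAt_px hΩ hx) h0
  refine h1.deriv.trans ?_
  rw [eq_neg_of_add_eq_zero_left (hs x t hx), dlog]
  field_simp
  ring

theorem eq_evalDK_miura {f u : ℝ → ℝ → 𝕜} {ξ : 𝕜} (hf : SmoothOn Ω f) (hΩ : IsOpen Ω)
    (hf0 : ∀ x t, (x, t) ∈ Ω → f x t ≠ 0)
    (hs : ∀ x t, (x, t) ∈ Ω → px (px f) x t + (ξ + u x t) * f x t = 0) (hx : (x, t) ∈ Ω) :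
    u x t = evalDK (dlog f) x t (miura ξ) := by
  have := px_dlog hf hΩ hf0 hs hx
  simp only [miura, map_sub, map_neg, map_pow, evalDK_C, evalDK_X, Function.iterate_zero,
    Function.iterate_one, id, this]
  ring

theorem darbouxPotential_eq_evalDK {f u : ℝ → ℝ → 𝕜} {ξ : 𝕜} (hf : SmoothOn Ω f)
    (hΩ : IsOpen Ω) (hf0 : ∀ x t, (x, t) ∈ Ω → f x t ≠ 0)
    (hs : ∀ x t, (x, t) ∈ Ω → px (px f) x t + (ξ + u x t) * f x t = 0) (hx : (x, t) ∈ Ω) :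
    darbouxPotential f u x t = evalDK (dlog f) x t (miuraBar ξ) := by
  have := px_dlog hf hΩ hf0 hs hx
  change u x t + 2 * px (dlog f) x t = _
  simp only [miuraBar, map_add, map_sub, map_neg, map_pow, evalDK_C, evalDK_X,
    Function.iterate_zero, Function.iterate_one, id, this]
  ring

/-- From ∂² + u + ξ = (∂ + v)(∂ - v): applying ∂ + v to ψ̄ gives (∂² + u + ξ)ψ = -(μ - ξ)ψ. -/
theorem hasDerivAt_darboux {f u ψ : ℝ → ℝ → 𝕜} {ξ μ : 𝕜} (hf : SmoothOn Ω f)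
    (hΩ : IsOpen Ω) (hf0 : ∀ x t, (x, t) ∈ Ω → f x t ≠ 0)
    (hs : ∀ x t, (x, t) ∈ Ω → px (px f) x t + (ξ + u x t) * f x t = 0)
    (hψ : SmoothOn Ω ψ)
    (hψs : ∀ x t, (x, t) ∈ Ω → px (px ψ) x t + (μ + u x t) * ψ x t = 0) (hx : (x, t) ∈ Ω) :
    HasDerivAt (fun y => darboux f ψ y t)
      (-(μ - ξ) * ψ x t - dlog f x t * darboux f ψ x t) x := by
  have h1 := ((hψ.px hΩ).hasDerivAt_px hΩ hx).fun_sub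
    (((smoothOn_dlog hf hΩ hf0).hasDerivAt_px hΩ hx).fun_mul (hψ.hasDerivAt_px hΩ hx))
  refine h1.congr_deriv ?_
  rw [eq_neg_of_add_eq_zero_left (hψs x t hx), px_dlog hf hΩ hf0 hs hx]
  change _ = -(μ - ξ) * ψ x t - dlog f x t * (px ψ x t - dlog f x t * ψ x t)
  ring

theorem px_darboux {f u ψ : ℝ → ℝ → 𝕜} {ξ μ : 𝕜} (hf : SmoothOn Ω f)
    (hΩ : IsOpen Ω) (hf0 : ∀ x t, (x, t) ∈ Ω → f x t ≠ 0)
    (hs : ∀ x t, (x, t) ∈ Ω → px (px f) x t + (ξ + u x t) * f x t = 0)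
    (hψ : SmoothOn Ω ψ)
    (hψs : ∀ x t, (x, t) ∈ Ω → px (px ψ) x t + (μ + u x t) * ψ x t = 0) (hx : (x, t) ∈ Ω) :
    px (darboux f ψ) x t = -(μ - ξ) * ψ x t - dlog f x t * darboux f ψ x t :=
  (hasDerivAt_darboux hf hΩ hf0 hs hψ hψs hx).deriv

/-- Interchanging the factors ∂ + v and ∂ - v replaces u by ū. The constant c allows one statement
to serve the sources (c = 1 / r_j) and the wave function (c = 1). -/
theorem spectral_const_mul_darboux {f u ψ : ℝ → ℝ → 𝕜} {ξ μ : 𝕜} (hf : SmoothOn Ω f)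
    (hΩ : IsOpen Ω) (hf0 : ∀ x t, (x, t) ∈ Ω → f x t ≠ 0)
    (hs : ∀ x t, (x, t) ∈ Ω → px (px f) x t + (ξ + u x t) * f x t = 0)
    (hψ : SmoothOn Ω ψ)
    (hψs : ∀ x t, (x, t) ∈ Ω → px (px ψ) x t + (μ + u x t) * ψ x t = 0) (c : 𝕜)
    (hx : (x, t) ∈ Ω) :
    px (px (fun x t => c * darboux f ψ x t)) x t
      + (μ + darbouxPotential f u x t) * (c * darboux f ψ x t) = 0 := by
  have h1 : ∀ x t, (x, t) ∈ Ω → px (fun x t => c * darboux f ψ x t) x t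
      = c * (-(μ - ξ) * ψ x t - dlog f x t * darboux f ψ x t) := fun x t hx =>
    ((hasDerivAt_darboux hf hΩ hf0 hs hψ hψs hx).const_mul c).deriv
  have h2 := ((((hψ.hasDerivAt_px hΩ hx).const_mul (-(μ - ξ))).fun_sub
    (((smoothOn_dlog hf hΩ hf0).hasDerivAt_px hΩ hx).fun_mul
      (hasDerivAt_darboux hf hΩ hf0 hs hψ hψs hx))).const_mul c).deriv
  rw [px_congr hΩ h1 hx]
  have h3 : px (fun x t => c * (-(μ - ξ) * ψ x t - dlog f x t * darboux f ψ x t)) x t = _ := h2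
  rw [h3]
  change _ + (μ + (u x t + 2 * px (dlog f) x t)) * _ = 0
  rw [px_dlog hf hΩ hf0 hs hx]
  change c * (_ - (_ * (px ψ x t - dlog f x t * ψ x t) + _ * (_ - _ * (px ψ x t - dlog f x t * ψ x t)))) + (μ + (u x t + 2 * _)) * (c * (px ψ x t - dlog f x t * ψ x t)) = 0
  ring

/-- The Wronskian `φ_x ψ - φ ψ_x` of two wave functions is an antiderivative of
`(μ - λ) φ ψ`. -/
theorem hasDerivAt_wronskian {u φ ψ : ℝ → ℝ → 𝕜} {l μ : 𝕜} (hΩ : IsOpen Ω)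
    (hφ : SmoothOn Ω φ) (hφs : ∀ x t, (x, t) ∈ Ω → px (px φ) x t + (l + u x t) * φ x t = 0)
    (hψ : SmoothOn Ω ψ) (hψs : ∀ x t, (x, t) ∈ Ω → px (px ψ) x t + (μ + u x t) * ψ x t = 0)
    (hx : (x, t) ∈ Ω) :
    HasDerivAt (fun y => px φ y t * ψ y t - φ y t * px ψ y t)
      ((μ - l) * (φ x t * ψ x t)) x := by
  refine ((((hφ.px hΩ).hasDerivAt_px hΩ hx).fun_mul (hψ.hasDerivAt_px hΩ hx)).fun_sub
    ((hφ.hasDerivAt_px hΩ hx).fun_mul ((hψ.px hΩ).hasDerivAt_px hΩ hx))).congr_deriv ?_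
  rw [eq_neg_of_add_eq_zero_left (hφs x t hx), eq_neg_of_add_eq_zero_left (hψs x t hx)]
  ring

/-! ### Sources and time evolution -/

variable {n N : ℕ} {α η ξ : 𝕜} {lam : Fin N → 𝕜} {r : Fin N → 𝕜} {u f : ℝ → ℝ → 𝕜}
  {φ : Fin N → ℝ → ℝ → 𝕜}

theorem ne_zero_of_sq_eq_sub (hξ : ∀ j, lam j ≠ ξ) (hr : ∀ j, r j ^ 2 = lam j - ξ) (j : Fin N) :
    r j ≠ 0 := by
  intro h0
  have := hr j
  rw [h0, zero_pow two_ne_zero] at this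
  exact hξ j (sub_eq_zero.mp this.symm)

/-- The Wronskian of φ_j and f equals r_j φ̄_j f. Its decay at -∞ makes it, after division by ξ -
λ_j = -r_j², the antiderivative selected by ∂⁻¹. The nonlocal term thereby becomes local. -/
theorem dInv_source_mul (hΩ : LeftDomain Ω) (hξ : ∀ j, lam j ≠ ξ)
    (hr : ∀ j, r j ^ 2 = lam j - ξ) (hu : IsSourceSolution Ω n α lam u φ)
    (hf : IsLaxSolution Ω n α η u φ ξ f) (hf0 : ∀ x t, (x, t) ∈ Ω → f x t ≠ 0) (j : Fin N)
    (hx : (x, t) ∈ Ω) :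
    dInv (fun y s => φ j y s * f y s) x t = -(darbouxSource r f φ j x t / r j * f x t) := by
  have hd : ξ - lam j ≠ 0 := sub_ne_zero.mpr (hξ j).symm
  have h0 := (hf.decay j x t hx).const_mul (ξ - lam j)⁻¹
  rw [mul_zero] at h0
  have := hasDInv_of_hasDerivAt ((hu.smooth_φ j).mul hf.smooth) hΩ hx (fun y hy =>
    ((hasDerivAt_wronskian hΩ.1 (hu.smooth_φ j) (hu.spectral j) hf.smooth hf.spectral
      hy).const_mul (ξ - lam j)⁻¹).congr_deriv (inv_mul_cancel_left₀ hd _)) h0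
  have hrj := ne_zero_of_sq_eq_sub hξ hr j
  have h1 := hf0 x t hx
  rw [this.dInv_eq, darbouxSource, darboux, ← neg_sub, ← hr j]
  field_simp

/-- The normalization by r_j makes the system for φ_j, φ̄_j skew: the off-diagonal coefficients are
r_j here and in `px_source`, with opposite signs. -/
theorem hasDerivAt_darbouxSource (hΩ : IsOpen Ω) (hξ : ∀ j, lam j ≠ ξ)
    (hr : ∀ j, r j ^ 2 = lam j - ξ) (hu : IsSourceSolution Ω n α lam u φ)
    (hf : IsLaxSolution Ω n α η u φ ξ f) (hf0 : ∀ x t, (x, t) ∈ Ω → f x t ≠ 0) (j : Fin N)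
    (hx : (x, t) ∈ Ω) :
    HasDerivAt (fun y => darbouxSource r f φ j y t)
      (-(r j * φ j x t) - dlog f x t * darbouxSource r f φ j x t) x := by
  have hrj := ne_zero_of_sq_eq_sub hξ hr j
  refine ((hasDerivAt_darboux hf.smooth hΩ hf0 hf.spectral (hu.smooth_φ j) (hu.spectral j)
    hx).const_mul (1 / r j)).congr_deriv ?_
  rw [darbouxSource, ← hr j]
  field_simp

theorem px_source (hξ : ∀ j, lam j ≠ ξ) (hr : ∀ j, r j ^ 2 = lam j - ξ) (j : Fin N) :
    px (φ j) x t = r j * darbouxSource r f φ j x t + dlog f x t * φ j x t := by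
  have hrj := ne_zero_of_sq_eq_sub hξ hr j
  rw [darbouxSource, ← mul_assoc, mul_one_div_cancel hrj]
  change _ = 1 * (px (φ j) x t - dlog f x t * φ j x t) + _
  ring

theorem pt_seed (hΩ : LeftDomain Ω) (hξ : ∀ j, lam j ≠ ξ)
    (hr : ∀ j, r j ^ 2 = lam j - ξ) (hu : IsSourceSolution Ω n α lam u φ)
    (hf : IsLaxSolution Ω n α η u φ ξ f) (hf0 : ∀ x t, (x, t) ∈ Ω → f x t ≠ 0)
    (hx : (x, t) ∈ Ω) :
    pt f x t = (-(1 / 2 * evalDK (dlog f) x t (totalDK 𝕜 (bSum (miura ξ) ξ (n + 1))))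
      + evalDK (dlog f) x t (bSum (miura ξ) ξ (n + 1)) * dlog f x t + η
      - α * ∑ j, φ j x t * (darbouxSource r f φ j x t / r j)) * f x t := by
  have hv := smoothOn_dlog hf.smooth hΩ.1 hf0
  rw [hf.evolution x t hx, opA_eq_evalDK hv hΩ.1
    (fun _ _ h => eq_evalDK_miura hf.smooth hΩ.1 hf0 hf.spectral h) n ξ f hx,
    px_eq_mul_dlog (hf0 x t hx), opB]
  simp only [dInv_source_mul hΩ hξ hr hu hf hf0 _ hx, mul_neg, Finset.sum_neg_distrib,
    ← mul_assoc, ← Finset.sum_mul]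
  ring

/-- In the derivative of φ_j φ̄_j the two terms with v cancel, because v enters the equations of φ_j
and φ̄_j with opposite signs. -/
theorem hasDerivAt_sum_source_mul (hΩ : IsOpen Ω) (hξ : ∀ j, lam j ≠ ξ)
    (hr : ∀ j, r j ^ 2 = lam j - ξ) (hu : IsSourceSolution Ω n α lam u φ)
    (hf : IsLaxSolution Ω n α η u φ ξ f) (hf0 : ∀ x t, (x, t) ∈ Ω → f x t ≠ 0)
    (hx : (x, t) ∈ Ω) :
    HasDerivAt (fun y => ∑ j, φ j y t * (darbouxSource r f φ j y t / r j))
      (∑ j, (darbouxSource r f φ j x t ^ 2 - φ j x t ^ 2)) x := by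
  refine HasDerivAt.fun_sum fun j _ => ?_
  have hrj := ne_zero_of_sq_eq_sub hξ hr j
  refine (((hu.smooth_φ j).hasDerivAt_px hΩ hx).fun_mul
    ((hasDerivAt_darbouxSource hΩ hξ hr hu hf hf0 j hx).div_const (r j))).congr_deriv ?_
  rw [px_source (f := f) hξ hr j]
  field_simp
  ring

/-- Here v_t = ∂(f_t / f), with f_t / f local by `pt_seed`; the constant η drops out. -/
theorem pt_dlog (hΩ : LeftDomain Ω) (hξ : ∀ j, lam j ≠ ξ)
    (hr : ∀ j, r j ^ 2 = lam j - ξ) (hu : IsSourceSolution Ω n α lam u φ)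
    (hf : IsLaxSolution Ω n α η u φ ξ f) (hf0 : ∀ x t, (x, t) ∈ Ω → f x t ≠ 0)
    (hx : (x, t) ∈ Ω) :
    pt (dlog f) x t = -evalDK (dlog f) x t (darbouxShift (bSum (miura ξ) ξ (n + 1)))
      - α * ∑ j, (darbouxSource r f φ j x t ^ 2 - φ j x t ^ 2) := by
  have hv := smoothOn_dlog hf.smooth hΩ.1 hf0
  have h0 := hf0 x t hx
  have h1 : pt (dlog f) x t = (pt (px f) x t * f x t - px f x t * pt f x t) / f x t ^ 2 :=
    (((hf.smooth.px hΩ.1).hasDerivAt_pt hΩ.1 hx).fun_div (hf.smooth.hasDerivAt_pt hΩ.1 hx) h0).deriv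
  set β := bSum (miura ξ) ξ (n + 1) with hβ
  have h2 := ((((((hasDerivAt_evalDK hv hΩ.1 hx (totalDK 𝕜 β)).const_mul (1 / 2)).fun_neg.fun_add
    ((hasDerivAt_evalDK hv hΩ.1 hx β).fun_mul (hv.hasDerivAt_px hΩ.1 hx))).add_const η).fun_sub
    ((hasDerivAt_sum_source_mul hΩ.1 hξ hr hu hf hf0 hx).const_mul α)).fun_mul
    (hf.smooth.hasDerivAt_px hΩ.1 hx)).deriv
  have h3 := px_congr hΩ.1 (fun _ _ h => pt_seed hΩ hξ hr hu hf hf0 h) hx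
  rw [h1, hf.smooth.pt_px hΩ.1 hx, h3, pt_seed hΩ hξ hr hu hf hf0 hx]
  rw [div_eq_iff (pow_ne_zero 2 h0)]
  refine (congrArg (fun z => z * f x t - _) h2).trans ?_
  simp only [darbouxShift, map_sub, map_mul, totalDK_mul, map_add, totalDK_X, evalDK_X, evalDK_C,
    Function.iterate_zero, zero_add, Function.iterate_one, id, px_eq_mul_dlog h0, ← hβ]
  ring

theorem isSourceSolution_darboux (hΩ : LeftDomain Ω) (hξ : ∀ j, lam j ≠ ξ)
    (hr : ∀ j, r j ^ 2 = lam j - ξ) (hu : IsSourceSolution Ω n α lam u φ)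
    (hf : IsLaxSolution Ω n α η u φ ξ f) (hf0 : ∀ x t, (x, t) ∈ Ω → f x t ≠ 0) :
    IsSourceSolution Ω n α lam (darbouxPotential f u) (darbouxSource r f φ) := by
  have hv := smoothOn_dlog hf.smooth hΩ.1 hf0
  have hφ : ∀ j, SmoothOn Ω (darbouxSource r f φ j) := fun j =>
    (smoothOn_darboux hf.smooth hΩ.1 hf0 (hu.smooth_φ j)).const_mul (1 / r j)
  refine ⟨hu.smooth_u.add ((hv.px hΩ.1).const_mul 2), hφ, fun x t hx => ?_, fun j x t hx =>
    spectral_const_mul_darboux hf.smooth hΩ.1 hf0 hf.spectral (hu.smooth_φ j) (hu.spectral j) _ hx⟩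
  -- The x-derivative of the flux, in a form that applies both to u, φ_j and to ū, φ̄_j.
  have hflux : ∀ {w : ℝ → ℝ → 𝕜} {U : MvPolynomial ℕ 𝕜} {χ : Fin N → ℝ → ℝ → 𝕜},
      (∀ x t, (x, t) ∈ Ω → w x t = evalDK (dlog f) x t U) → (∀ j, SmoothOn Ω (χ j)) →
      px (fun y s => -2 * evalDP (bPoly (n + 2)) w y s - 2 * α * ∑ j, χ j y s ^ 2) x t
        = -2 * evalDK (dlog f) x t (totalDK 𝕜 (bAt U (n + 2)))
          - 2 * α * ∑ j, 2 * χ j x t * px (χ j) x t := by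
    intro w U χ hw hχ
    rw [px_congr hΩ.1 (fun y s h => by rw [evalDP_eq_evalDK hv hΩ.1 hw _ h]) hx]
    refine HasDerivAt.deriv (((hasDerivAt_evalDK hv hΩ.1 hx _).const_mul (-2)).fun_sub
      ((HasDerivAt.fun_sum fun j _ => ?_).const_mul (2 * α)))
    simpa using ((hχ j).hasDerivAt_px hΩ.1 hx).fun_pow 2
  have h1 : pt (darbouxPotential f u) x t = pt u x t + 2 * pt (px (dlog f)) x t :=
    ((hu.smooth_u.hasDerivAt_pt hΩ.1 hx).fun_add
      (((hv.px hΩ.1).hasDerivAt_pt hΩ.1 hx).const_mul 2)).deriv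
  have h2 : px (pt (dlog f)) x t
      = -evalDK (dlog f) x t (totalDK 𝕜 (darbouxShift (bSum (miura ξ) ξ (n + 1))))
        - α * ∑ j, (2 * darbouxSource r f φ j x t * px (darbouxSource r f φ j) x t
          - 2 * φ j x t * px (φ j) x t) := by
    rw [px_congr hΩ.1 (fun _ _ h => pt_dlog hΩ hξ hr hu hf hf0 h) hx]
    refine HasDerivAt.deriv ((hasDerivAt_evalDK hv hΩ.1 hx _).fun_neg.fun_sub
      ((HasDerivAt.fun_sum fun j _ => ?_).const_mul α))
    simpa using (((hφ j).hasDerivAt_px hΩ.1 hx).fun_pow 2).fun_sub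
      (((hu.smooth_φ j).hasDerivAt_px hΩ.1 hx).fun_pow 2)
  rw [h1, hv.pt_px hΩ.1 hx, h2, hu.evolution x t hx,
    hflux (fun _ _ h => eq_evalDK_miura hf.smooth hΩ.1 hf0 hf.spectral h) hu.smooth_φ,
    hflux (fun _ _ h => darbouxPotential_eq_evalDK hf.smooth hΩ.1 hf0 hf.spectral h) hφ,
    bAt_miuraBar, map_add, map_add, Finset.sum_sub_distrib]
  ring

/-- The derivative of r_j ∂⁻¹(φ_j ψ) + φ̄_j ψ is φ̄_j (ψ_x - v ψ), as the terms r_j φ_j ψ cancel. At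
-∞ the first summand vanishes as a tail and the second by the extra decay hypothesis. -/
theorem hasDInv_darbouxSource_mul (hΩ : LeftDomain Ω) (hξ : ∀ j, lam j ≠ ξ)
    (hr : ∀ j, r j ^ 2 = lam j - ξ) (hu : IsSourceSolution Ω n α lam u φ)
    (hf : IsLaxSolution Ω n α η u φ ξ f) (hf0 : ∀ x t, (x, t) ∈ Ω → f x t ≠ 0)
    {μ : 𝕜} {ψ : ℝ → ℝ → 𝕜} (hψ : IsLaxSolution Ω n α η u φ μ ψ)
    (hdec : ∀ j, DecaysOn Ω (fun x t => darbouxSource r f φ j x t * ψ x t)) (j : Fin N)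
    (hx : (x, t) ∈ Ω) :
    HasDInv (fun y s => darbouxSource r f φ j y s * darboux f ψ y s) x t
      (r j * dInv (fun y s => φ j y s * ψ y s) x t + darbouxSource r f φ j x t * ψ x t) := by
  have hm := (hu.smooth_φ j).mul hψ.smooth
  have h0 := ((tendsto_dInv hm hΩ hx (hψ.convergent j x t hx)).const_mul (r j)).add (hdec j x t hx)
  rw [mul_zero, add_zero] at h0
  refine hasDInv_of_hasDerivAt
    (G := fun y => r j * dInv (fun y s => φ j y s * ψ y s) y t + darbouxSource r f φ j y t * ψ y t)
    (((smoothOn_darboux hf.smooth hΩ.1 hf0 (hu.smooth_φ j)).const_mul (1 / r j)).mul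
      (smoothOn_darboux hf.smooth hΩ.1 hf0 hψ.smooth)) hΩ hx (fun y hy => ?_) h0
  refine (((hasDerivAt_dInv hm hΩ hy (hψ.convergent j y t hy)).const_mul (r j)).fun_add
    ((hasDerivAt_darbouxSource hΩ.1 hξ hr hu hf hf0 j hy).fun_mul
      (hψ.smooth.hasDerivAt_px hΩ.1 hy))).congr_deriv ?_
  change _ = darbouxSource r f φ j y t * (px ψ y t - dlog f y t * ψ y t)
  ring

/-- Everything is expressed through ψ, ψ̄ and the integrals ∂⁻¹(φ_j ψ). The local part of ψ̄_t has
coefficient ½ S_x - v S at ψ̄, handled by `bSum_miuraBar_coeff`, and -(μ - ξ) S̄ at ψ, where S and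
S̄ are the sums at μ for u and ū. -/
theorem pt_darboux (hΩ : LeftDomain Ω) (hξ : ∀ j, lam j ≠ ξ)
    (hr : ∀ j, r j ^ 2 = lam j - ξ) (hu : IsSourceSolution Ω n α lam u φ)
    (hf : IsLaxSolution Ω n α η u φ ξ f) (hf0 : ∀ x t, (x, t) ∈ Ω → f x t ≠ 0)
    {μ : 𝕜} {ψ : ℝ → ℝ → 𝕜} (hψ : IsLaxSolution Ω n α η u φ μ ψ)
    (hdec : ∀ j, DecaysOn Ω (fun x t => darbouxSource r f φ j x t * ψ x t))
    (hx : (x, t) ∈ Ω) :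
    pt (darboux f ψ) x t = opA n (darbouxPotential f u) μ (darboux f ψ) x t
      + η * darboux f ψ x t + opB α (darbouxSource r f φ) (darboux f ψ) x t := by
  have hv := smoothOn_dlog hf.smooth hΩ.1 hf0
  have hw := fun x t h => eq_evalDK_miura (x := x) (t := t) hf.smooth hΩ.1 hf0 hf.spectral h
  have hwb := fun x t h =>
    darbouxPotential_eq_evalDK (x := x) (t := t) hf.smooth hΩ.1 hf0 hf.spectral h
  set S := bSum (miura ξ) μ (n + 1) with hS
  set I : Fin N → ℝ → ℝ → 𝕜 := fun j => dInv (fun y s => φ j y s * ψ y s) with hI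
  have hevol : ∀ x t, (x, t) ∈ Ω → pt ψ x t
      = -(1 / 2 * evalDK (dlog f) x t (totalDK 𝕜 S)) * ψ x t
        + evalDK (dlog f) x t S * px ψ x t + η * ψ x t + α * ∑ j, φ j x t * I j x t := by
    intro x t hx
    rw [hψ.evolution x t hx, opA_eq_evalDK hv hΩ.1 hw n μ ψ hx, opB]
  have h1 : pt (darboux f ψ) x t
      = pt (px ψ) x t - (pt (dlog f) x t * ψ x t + dlog f x t * pt ψ x t) :=
    (((hψ.smooth.px hΩ.1).hasDerivAt_pt hΩ.1 hx).fun_sub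
      ((hv.hasDerivAt_pt hΩ.1 hx).fun_mul (hψ.smooth.hasDerivAt_pt hΩ.1 hx))).deriv
  have h2 := ((((((hasDerivAt_evalDK hv hΩ.1 hx (totalDK 𝕜 S)).const_mul (1 / 2)).fun_neg.fun_mul
    (hψ.smooth.hasDerivAt_px hΩ.1 hx)).fun_add ((hasDerivAt_evalDK hv hΩ.1 hx S).fun_mul
    ((hψ.smooth.px hΩ.1).hasDerivAt_px hΩ.1 hx))).fun_add
    ((hψ.smooth.hasDerivAt_px hΩ.1 hx).const_mul η)).fun_add
    ((HasDerivAt.fun_sum (u := Finset.univ) fun j _ =>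
      ((hu.smooth_φ j).hasDerivAt_px hΩ.1 hx).fun_mul (hasDerivAt_dInv
        ((hu.smooth_φ j).mul hψ.smooth) hΩ hx (hψ.convergent j x t hx))).const_mul α)).deriv
  have h3 : pt (px ψ) x t = _ := ((hψ.smooth.pt_px hΩ.1 hx).trans (px_congr hΩ.1 hevol hx)).trans h2
  have hB : opB α (darbouxSource r f φ) (darboux f ψ) x t = α * ∑ j,
      ((r j * darbouxSource r f φ j x t) * I j x t + darbouxSource r f φ j x t ^ 2 * ψ x t) := by
    rw [opB]
    congr 1
    refine Finset.sum_congr rfl fun j _ => ?_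
    rw [(hasDInv_darbouxSource_mul hΩ hξ hr hu hf hf0 hψ hdec j hx).dInv_eq]
    ring
  -- The source terms of ψ_xt, once those of v ψ_t and v_t ψ are removed, are exactly the sources of
  -- the transformed equation.
  have hs : ∑ j, (px (φ j) x t * I j x t + φ j x t * (φ j x t * ψ x t))
      = ∑ j, ((r j * darbouxSource r f φ j x t) * I j x t + darbouxSource r f φ j x t ^ 2 * ψ x t)
        + dlog f x t * ∑ j, φ j x t * I j x t
        - (∑ j, (darbouxSource r f φ j x t ^ 2 - φ j x t ^ 2)) * ψ x t := by
    rw [Finset.mul_sum, Finset.sum_mul, ← Finset.sum_add_distrib, ← Finset.sum_sub_distrib]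
    refine Finset.sum_congr rfl fun j _ => ?_
    rw [px_source (f := f) hξ hr j]
    ring
  have hψxx : px (px ψ) x t = (px (dlog f) x t + dlog f x t ^ 2 + ξ - μ) * ψ x t := by
    rw [eq_neg_of_add_eq_zero_left (hψ.spectral x t hx),
      px_dlog hf.smooth hΩ.1 hf0 hf.spectral hx]
    ring
  have hbar := congrArg (evalDK (dlog f) x t) (bSum_miuraBar ξ μ (n + 1))
  have hcoeff := congrArg (evalDK (dlog f) x t) (bSum_miuraBar_coeff ξ μ (n + 1))
  -- The ψ-coefficient contains D S from ψ and D of the sum at ξ from v_t; their difference is μ - ξ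
  -- times the correction in S̄. No division by μ - ξ is needed.
  have hdiff : (μ - ξ) * evalDK (dlog f) x t (darbouxShift (bDiff (miura ξ) ξ μ (n + 1)))
      = evalDK (dlog f) x t (darbouxShift S)
        - evalDK (dlog f) x t (darbouxShift (bSum (miura ξ) ξ (n + 1))) := by
    have := congrArg (fun Q => evalDK (dlog f) x t (darbouxShift Q))
      (sub_eq_iff_eq_add.mp (sub_mul_bDiff (miura ξ) ξ μ (n + 1)).symm)
    simp only [← MvPolynomial.C_sub, darbouxShift_add, darbouxShift_C_mul, map_add, map_mul,
      evalDK_C] at this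
    rw [hS, this, add_sub_cancel_right]
  have hshift : evalDK (dlog f) x t (darbouxShift S)
      = 1 / 2 * evalDK (dlog f) x t (totalDK 𝕜 (totalDK 𝕜 S))
        - (px (dlog f) x t * evalDK (dlog f) x t S
          + dlog f x t * evalDK (dlog f) x t (totalDK 𝕜 S)) := by
    simp only [darbouxShift, map_sub, map_mul, totalDK_mul, map_add, totalDK_X, evalDK_X, evalDK_C,
      Function.iterate_zero, zero_add, Function.iterate_one, id]
  rw [h1, h3, pt_dlog hΩ hξ hr hu hf hf0 hx, hevol x t hx, hs, hB,
    opA_eq_evalDK hv hΩ.1 hwb n μ _ hx,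
    px_darboux hf.smooth hΩ.1 hf0 hf.spectral hψ.smooth hψ.spectral hx, hψxx]
  simp only [map_add, map_sub, map_neg, map_mul, evalDK_C, evalDK_X, Function.iterate_zero, id,
    ← hS] at hbar hcoeff
  have hdb : darboux f ψ x t = px ψ x t - dlog f x t * ψ x t := rfl
  rw [hdb]
  rw [hshift] at hdiff
  linear_combination ψ x t * hdiff + (μ - ξ) * ψ x t * hbar
    + (px ψ x t - dlog f x t * ψ x t) * hcoeff

theorem isLaxSolution_darboux (hΩ : LeftDomain Ω) (hξ : ∀ j, lam j ≠ ξ)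
    (hr : ∀ j, r j ^ 2 = lam j - ξ) (hu : IsSourceSolution Ω n α lam u φ)
    (hf : IsLaxSolution Ω n α η u φ ξ f) (hf0 : ∀ x t, (x, t) ∈ Ω → f x t ≠ 0)
    {μ : 𝕜} {ψ : ℝ → ℝ → 𝕜} (hψ : IsLaxSolution Ω n α η u φ μ ψ)
    (hdec : ∀ j, DecaysOn Ω (fun x t => darbouxSource r f φ j x t * ψ x t)) :
    IsLaxSolution Ω n α η (darbouxPotential f u) (darbouxSource r f φ) μ (darboux f ψ) := by
  refine ⟨smoothOn_darboux hf.smooth hΩ.1 hf0 hψ.smooth, fun j x t hx => ?_, fun j x t hx =>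
    ⟨_, hasDInv_darbouxSource_mul hΩ hξ hr hu hf hf0 hψ hdec j hx⟩, fun x t hx => ?_,
    fun x t hx => pt_darboux hΩ hξ hr hu hf hf0 hψ hdec hx⟩
  -- The transformed Wronskian equals r_j (φ_{j,x} ψ - φ_j ψ_x) + (μ - λ_j) φ̄_j ψ, with λ_j = ξ +
  -- r_j²; both summands decay.
  · have h1 := ((hψ.decay j x t hx).const_mul (r j)).add
      ((hdec j x t hx).const_mul (μ - ξ - r j ^ 2))
    rw [mul_zero, mul_zero, add_zero] at h1
    refine h1.congr' ?_
    filter_upwards [Filter.eventually_le_atBot x] with y hy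
    have hy' := hΩ.2 _ _ _ hx hy
    have e1 : px (darbouxSource r f φ j) y t = _ :=
      (hasDerivAt_darbouxSource hΩ.1 hξ hr hu hf hf0 j hy').deriv
    rw [e1, px_darboux hf.smooth hΩ.1 hf0 hf.spectral hψ.smooth hψ.spectral hy',
      px_source (f := f) hξ hr j]
    change _ = (_ - _) * (px ψ y t - dlog f y t * ψ y t)
      - _ * (_ - _ * (px ψ y t - dlog f y t * ψ y t))
    ring
  · simpa only [one_mul] using spectral_const_mul_darboux hf.smooth hΩ.1 hf0 hf.spectral hψ.smooth
      hψ.spectral 1 hx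

end Darboux

end KdVSources

open KdVSources
theorem theorem4p1 {𝕜 : Type*} [RCLike 𝕜] (Ω : Set (ℝ × ℝ)) (hΩ : LeftDomain Ω)
    (n N : ℕ) (α η : 𝕜) (lam : Fin N → 𝕜) (ξ : 𝕜) (r : Fin N → 𝕜)
    (hξ : ∀ j, lam j ≠ ξ) (hr : ∀ j, r j ^ 2 = lam j - ξ)
    (u : ℝ → ℝ → 𝕜) (φ : Fin N → ℝ → ℝ → 𝕜) (hu : IsSourceSolution Ω n α lam u φ)
    (f : ℝ → ℝ → 𝕜) (hf : IsLaxSolution Ω n α η u φ ξ f)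
    (hf0 : ∀ x t, (x, t) ∈ Ω → f x t ≠ 0) :
    IsSourceSolution Ω n α lam (darbouxPotential f u) (darbouxSource r f φ) ∧
    ∀ (mu : 𝕜) (ψ : ℝ → ℝ → 𝕜), IsLaxSolution Ω n α η u φ mu ψ →
      (∀ j, DecaysOn Ω (fun x t => darbouxSource r f φ j x t * ψ x t)) →
      IsLaxSolution Ω n α η (darbouxPotential f u) (darbouxSource r f φ) mu (darboux f ψ) :=
  ⟨isSourceSolution_darboux hΩ hξ hr hu hf hf0, fun _ _ hψ hdec =>
    isLaxSolution_darboux hΩ hξ hr hu hf hf0 hψ hdec⟩
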